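/- Let $(X,\tau)$ be a Hausdorff real topological vector space with origin $\theta$, and write $\mathbb{R}^+=[0,\infty)$. A functional $u:X\to\mathbb{R}$ is called originally m-quasiconvex if $u(\theta)=0$ and $$|u(\alpha x_1+(1-\alpha)x_2)|\le \max\{|u(x_1)|,|u(x_2)|\}\qquad\text{for all }x_1,x_2\in X,\ 0\le\alpha\le 1 .$$ Suppose that $X$ is quasi-point separable, that is, there are an index set $\Lambda$ and, for every $\lambda\in\Lambda$, a functional $v_\lambda:X\to\mathbb{R}$ (not necessarily continuous), a $\tau$-continuous originally m-quasiconvex functional $u_\lambda:X\to\mathbb{R}$ and a function $\psi_\lambda:\mathbb{R}^+\to\mathbb{R}^+$ (not necessarily continuous or monotone) such that 1. $|v_\lambda(x)|\le\psi_\lambda(|u_\lambda(x)|)$ for all $x\in X$ and $\lambda\in\Lambda$; 2. $\psi_\lambda(0)=0$ and $\psi_\lambda(t)>0$ for all $t>0$ and $\lambda\in\Lambda$; 3. if $x\in X$ and $v_\lambda(x)=0$ for every $\lambda\in\Lambda$, then $x=\theta$. Let $C$ be a nonempty compact convex subset of $X$. Then every continuous map $f:C\to C$ has a fixed point. -/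

import Mathlib

open scoped NNReal

/-- A real functional `u` is m-quasiconvex if
`|u (α x₁ + (1 - α) x₂)| ≤ max |u x₁| |u x₂|` for all `x₁, x₂` and `0 ≤ α ≤ 1`. -/
def MQuasiconvex {X : Type*} [AddCommGroup X] [Module ℝ X] (u : X → ℝ) : Prop :=
  ∀ (x₁ x₂ : X) (α : ℝ), 0 ≤ α → α ≤ 1 →
    |u (α • x₁ + (1 - α) • x₂)| ≤ max |u x₁| |u x₂|

/-- An m-quasiconvex functional vanishing at the origin. -/
structure OriginallyMQuasiconvex {X : Type*} [AddCommGroup X] [Module ℝ X]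
    (u : X → ℝ) : Prop where
  mQuasiconvex : MQuasiconvex u
  map_zero : u 0 = 0

/-- `v` is generalized m-quasiconvex, with associated originally m-quasiconvex functional `u` and
weight function `ψ : [0, ∞) → [0, ∞)`. Neither continuity nor monotonicity is required of `ψ`, and
no continuity of `v`. The argument `‖u x‖₊` is `|u x|` as an element of `[0, ∞)`. -/
structure GeneralizedMQuasiconvexWith {X : Type*} [AddCommGroup X] [Module ℝ X]
    (v u : X → ℝ) (ψ : ℝ≥0 → ℝ≥0) : Prop where
  originally : OriginallyMQuasiconvex u
  abs_le : ∀ x, |v x| ≤ (ψ ‖u x‖₊ : ℝ)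
  weight_zero : ψ 0 = 0
  weight_pos : ∀ t, 0 < t → 0 < ψ t

/-- The family `(v i, u i, ψ i)` is a quasi-point separating space for `X`: every `v i` is
generalized m-quasiconvex with continuous associated functional `u i` and weight `ψ i`, and the
`v i` vanish simultaneously only at the origin. -/
structure IsQuasiPointSeparatingSpace {X : Type*} [AddCommGroup X] [Module ℝ X]
    [TopologicalSpace X] {Λ : Type*} (v u : Λ → X → ℝ) (ψ : Λ → ℝ≥0 → ℝ≥0) : Prop where
  generalized : ∀ i, GeneralizedMQuasiconvexWith (v i) (u i) (ψ i)
  continuous : ∀ i, Continuous (u i)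
  separating : ∀ x, (∀ i, v i x = 0) → x = 0

/-! Suppose `f` has no fixed point. If every `u i` vanished at `x - f x`, the weights would force
every `v i` to vanish there too, so some `u i (x - f x)` is nonzero. By compactness finitely many
indices suffice for all `x`. The maximum `q` of these `|u i|` is continuous, vanishes at the origin
and has convex strict sublevel sets, so it can play the part of a seminorm although `X` need not be
locally convex. On `C` the function `q (x - f x)` attains a positive minimum `r`.

A Schauder projection onto the hull of finitely many points of `C` contradicts this: Brouwer's
theorem for a simplex yields `x` with `q (x - f x) < r` (`exists_gauge_sub_lt`). Brouwer's theorem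
rests on Scarf's lemma, a parity count of dominating sets that replaces Sperner's lemma and needs no
triangulation. -/

/-! ### Scarf's combinatorial lemma -/

section Scarf

open Finset

/-- A finite set `σ` is dominating for a family of orders (given by the injective ranking functions
`h i`) if no element lies strictly above the minimum of `σ` in every order. -/
def IsDominating {I S L : Type*} [LinearOrder L] (h : I → S → L) (σ : Finset S) : Prop :=
  ∀ y, ∃ i, ∀ x ∈ σ, h i y ≤ h i x

variable {I S L : Type*} [LinearOrder L] {h : I → S → L}

theorem IsDominating.mono {σ τ : Finset S} (hσ : IsDominating h σ) (hτ : τ ⊆ σ) :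
    IsDominating h τ := fun y ↦
  let ⟨i, hi⟩ := hσ y
  ⟨i, fun x hx ↦ hi x (hτ hx)⟩

/-- In a dominating set with as many elements as there are orders, every element is the minimum
for exactly one order. -/
theorem IsDominating.exists_argmin [Fintype I] (hinj : ∀ i, Function.Injective (h i))
    {σ : Finset S} (hσ : IsDominating h σ) (hne : σ.Nonempty) (hcard : #σ = Fintype.card I) :
    ∃ m : I → S, Function.Injective m ∧ (∀ i, m i ∈ σ) ∧ (∀ x ∈ σ, ∃ i, m i = x) ∧
      ∀ i, ∀ x ∈ σ, h i (m i) ≤ h i x := by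
  classical
  choose m hm hmin using fun i ↦ σ.exists_min_image (h i) hne
  have hsurj : ∀ x ∈ σ, ∃ i, m i = x := fun x hx ↦ by
    obtain ⟨i, hi⟩ := hσ x
    exact ⟨i, hinj i (le_antisymm (hmin i x hx) (hi _ (hm i)))⟩
  refine ⟨m, ?_, hm, hsurj, hmin⟩
  have himg : univ.image m = σ := by
    ext x
    simp only [mem_image, mem_univ, true_and]
    exact ⟨fun ⟨i, hi⟩ ↦ hi ▸ hm i, hsurj x⟩
  have : #(univ.image m) = #(univ : Finset I) := by rw [himg, hcard, card_univ]
  simpa using card_image_iff.1 this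

/-- A dominating set with one element less than the number of orders, containing an element that is
not a slack element, extends in exactly two ways to a dominating set of full size. -/
theorem IsDominating.card_extensions [Fintype I] [Fintype S] [DecidableEq S]
    (hinj : ∀ i, Function.Injective (h i)) {e : I → S}
    (hslack : ∀ i j, j ≠ i → ∀ t, (∀ k, t ≠ e k) → h i t < h i (e j))
    {τ : Finset S} (hτ : IsDominating h τ) (hcard : #τ + 1 = Fintype.card I)
    {t : S} (htτ : t ∈ τ) (ht : ∀ k, t ≠ e k)
    [DecidablePred fun x ↦ x ∉ τ ∧ IsDominating h (insert x τ)] :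
    #{x | x ∉ τ ∧ IsDominating h (insert x τ)} = 2 := by
  classical
  choose m hm hmin using fun i ↦ τ.exists_min_image (h i) ⟨t, htτ⟩
  -- There is one more order than elements of `τ`, so two orders share their minimum; the two
  -- extensions come from these two orders.
  obtain ⟨i, -, j, -, hij, hmij⟩ := exists_ne_map_eq_of_card_lt_of_maps_to
    (s := (univ : Finset I)) (t := τ) (f := m) (by rw [card_univ]; omega) (fun i _ ↦ hm i)
  -- A new element that becomes the minimum for order `k` only must lie in `M k`; domination forces
  -- it to be the `k`-largest member `a k`.
  let M : I → Finset S := fun k ↦ {y | ∀ l, l ≠ k → h l (m l) < h l y}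
  have hM : ∀ k y, y ∈ M k ↔ ∀ l, l ≠ k → h l (m l) < h l y := fun k y ↦ by simp [M]
  have hMne : ∀ k, (M k).Nonempty := fun k ↦
    ⟨e k, (hM _ _).2 fun l hl ↦ (hmin l t htτ).trans_lt (hslack l k hl.symm t ht)⟩
  choose a ha hamax using fun k ↦ (M k).exists_max_image (h k) (hMne k)
  have hle : ∀ k, h k (a k) ≤ h k (m k) := fun k ↦ by
    obtain ⟨l, hl⟩ := hτ (a k)
    obtain rfl | hlk := eq_or_ne l k
    · exact hl _ (hm l)
    · exact absurd ((hM _ _).1 (ha k) l hlk) (hl _ (hm l)).not_gt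
  have hdom : ∀ k, IsDominating h (insert (a k) τ) := fun k y ↦ by
    by_cases hy : y ∈ M k
    · refine ⟨k, fun x hx ↦ ?_⟩
      obtain rfl | hx := mem_insert.1 hx
      · exact hamax k y hy
      · exact ((hamax k y hy).trans (hle k)).trans (hmin k x hx)
    · rw [hM] at hy
      push Not at hy
      obtain ⟨l, hlk, hl⟩ := hy
      refine ⟨l, fun x hx ↦ ?_⟩
      obtain rfl | hx := mem_insert.1 hx
      · exact hl.trans ((hM _ _).1 (ha k) l hlk).le
      · exact hl.trans (hmin l x hx)
  have hnot : ∀ k k', k ≠ k' → m k = m k' → a k ∉ τ := fun k k' hk hmk hak ↦ by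
    have h1 : a k = m k := hinj k (le_antisymm (hle k) (hmin k _ hak))
    have h2 := (hM _ _).1 (ha k) k' hk.symm
    rw [h1, hmk] at h2
    exact lt_irrefl _ h2
  have hset : ({x | x ∉ τ ∧ IsDominating h (insert x τ)} : Finset S) = {a i, a j} := by
    ext x
    simp only [mem_filter, mem_univ, true_and, mem_insert, mem_singleton]
    constructor
    · rintro ⟨hx, hd⟩
      obtain ⟨m', hm'inj, hm'mem, hm'surj, hm'min⟩ := hd.exists_argmin hinj (insert_nonempty x τ)
        (by rw [card_insert_of_notMem hx, hcard])
      obtain ⟨k, hk⟩ := hm'surj x (mem_insert_self x τ)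
      have hne : ∀ l, l ≠ k → m' l ≠ x := fun l hl hlx ↦ hl (hm'inj (hlx.trans hk.symm))
      have hmm : ∀ l, l ≠ k → m' l = m l := fun l hl ↦
        hinj l (le_antisymm (hm'min l _ (mem_insert_of_mem (hm l)))
          (hmin l _ ((mem_insert.1 (hm'mem l)).resolve_left (hne l hl))))
      have hxM : x ∈ M k := (hM _ _).2 fun l hl ↦ by
        rw [← hmm l hl]
        exact lt_of_le_of_ne (hm'min l x (mem_insert_self x τ)) fun hh ↦ hne l hl (hinj l hh)
      have hxa : x = a k := by
        refine hinj k (le_antisymm (hamax k x hxM) ?_)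
        obtain ⟨l, hl⟩ := hd (a k)
        obtain rfl | hlk := eq_or_ne l k
        · exact hl x (mem_insert_self x τ)
        · exact absurd ((hM _ _).1 (ha k) l hlk) (hl _ (mem_insert_of_mem (hm l))).not_gt
      by_cases hki : k = i
      · exact Or.inl (hki ▸ hxa)
      by_cases hkj : k = j
      · exact Or.inr (hkj ▸ hxa)
      -- For any other `k`, the orders `i` and `j` would still share a minimum in the full-size set.
      refine absurd (hm'inj (a₁ := i) (a₂ := j) ?_) hij
      rw [hmm i (Ne.symm hki), hmm j (Ne.symm hkj), hmij]
    · rintro (rfl | rfl)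
      · exact ⟨hnot i j hij hmij, hdom i⟩
      · exact ⟨hnot j i hij.symm hmij.symm, hdom j⟩
  rw [hset, card_pair]
  -- A common value of `a i` and `a j` would exceed the minimum of `τ` in every order.
  intro haij
  obtain ⟨l, hl⟩ := hτ (a i)
  have hl' := (hl _ (hm l)).not_gt
  by_cases hli : l = i
  · rw [haij] at hl'
    exact hl' ((hM _ _).1 (ha j) l (hli ▸ hij))
  · exact hl' ((hM _ _).1 (ha i) l hli)

/-- The set of all slack elements but one extends in exactly one way to a dominating set of full
size. -/
theorem card_extensions_slack [Fintype I] [Fintype S] [DecidableEq I] [DecidableEq S]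
    (hinj : ∀ i, Function.Injective (h i)) {e : I → S}
    (hbot : ∀ i y, y ≠ e i → h i (e i) < h i y)
    (hslack : ∀ i j, j ≠ i → ∀ t, (∀ k, t ≠ e k) → h i t < h i (e j))
    (i₀ : I) {τ : Finset S} (hτ : τ = (univ.erase i₀).image e) (he : Function.Injective e)
    [DecidablePred fun x ↦ x ∉ τ ∧ IsDominating h (insert x τ)] :
    #{x | x ∉ τ ∧ IsDominating h (insert x τ)} = 1 := by
  have hmem : ∀ y, y ∈ τ ↔ ∃ l, l ≠ i₀ ∧ e l = y := fun y ↦ by simp [hτ]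
  have hne : (τᶜ).Nonempty := ⟨e i₀, by
    rw [mem_compl, hmem]
    rintro ⟨l, hl, hle⟩
    exact hl (he hle)⟩
  obtain ⟨a, ha, hamax⟩ := τᶜ.exists_max_image (h i₀) hne
  rw [mem_compl] at ha
  rw [card_eq_one]
  refine ⟨a, ?_⟩
  ext x
  simp only [mem_filter, mem_univ, true_and, mem_singleton]
  constructor
  · rintro ⟨hx, hd⟩
    refine hinj i₀ (le_antisymm (hamax x (mem_compl.2 hx)) ?_)
    obtain ⟨l, hl⟩ := hd a
    obtain rfl | hli := eq_or_ne l i₀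
    · exact hl x (mem_insert_self x τ)
    · have hle : e l ∈ τ := (hmem _).2 ⟨l, hli, rfl⟩
      refine absurd (hl _ (mem_insert_of_mem hle)) (hbot l a ?_).not_ge
      rintro rfl
      exact ha hle
  · rintro rfl
    refine ⟨ha, fun y ↦ ?_⟩
    by_cases hy : y ∈ τ
    · obtain ⟨l, -, rfl⟩ := (hmem _).1 hy
      refine ⟨l, fun z _ ↦ ?_⟩
      obtain rfl | hz := eq_or_ne z (e l)
      · exact le_rfl
      · exact (hbot l z hz).le
    · refine ⟨i₀, fun z hz ↦ ?_⟩
      obtain rfl | hz := mem_insert.1 hz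
      · exact hamax y (mem_compl.2 hy)
      · obtain ⟨l, hl, rfl⟩ := (hmem _).1 hz
        by_cases hys : ∃ k, y = e k
        · obtain ⟨k, rfl⟩ := hys
          have hk : k = i₀ := by
            by_contra hk
            exact hy ((hmem _).2 ⟨k, hk, rfl⟩)
          subst hk
          exact (hbot k (e l) fun hh ↦ hl (he hh)).le
        · push Not at hys
          exact (hslack i₀ l hl y hys).le

/-- If removing some point of `σ` leaves exactly the colours different from `i₀`, while `σ` does not
carry all colours, then there are exactly two such points. -/
theorem even_card_facets [Fintype I] [DecidableEq I] [DecidableEq S] (c : S → I) (i₀ : I)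
    {σ : Finset S} (hcard : #σ = Fintype.card I) (hσ : σ.image c ≠ univ) :
    Even #{x ∈ σ | (σ.erase x).image c = univ.erase i₀} := by
  obtain hem | ⟨a, ha⟩ :=
    ({x ∈ σ | (σ.erase x).image c = univ.erase i₀} : Finset S).eq_empty_or_nonempty
  · simp [hem]
  rw [mem_filter] at ha
  obtain ⟨haσ, ha⟩ := ha
  -- Equal cardinalities make `c` injective off `a`. Hence the colour of `a` recurs at exactly one
  -- `b`, and only `a` and `b` are interchangeable.
  have hinj : Set.InjOn c (σ.erase a) := by
    rw [← card_image_iff, ha, card_erase_of_mem haσ, card_erase_of_mem (mem_univ _), hcard,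
      card_univ]
  have hca : c a ≠ i₀ := by
    intro hca
    apply hσ
    rw [← insert_erase haσ, image_insert, ha, hca, insert_erase (mem_univ _)]
  have : c a ∈ (σ.erase a).image c := by rw [ha]; simpa using hca
  obtain ⟨b, hb, hbc⟩ := mem_image.1 this
  obtain ⟨hba, hbσ⟩ := mem_erase.1 hb
  have hset : ({x ∈ σ | (σ.erase x).image c = univ.erase i₀} : Finset S) = {a, b} := by
    ext x
    simp only [mem_filter, mem_insert, mem_singleton]
    constructor
    · rintro ⟨hxσ, hx⟩
      by_contra! hxab
      have hxa : x ∈ σ.erase a := mem_erase.2 ⟨hxab.1, hxσ⟩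
      have h1 : c x ∈ (σ.erase x).image c := by
        rw [hx, ← ha]
        exact mem_image_of_mem c hxa
      obtain ⟨y, hy, hyx⟩ := mem_image.1 h1
      obtain ⟨hyx', hyσ⟩ := mem_erase.1 hy
      by_cases hya : y = a
      · exact hxab.2 (hinj hxa hb (by rw [← hyx, hya, hbc]))
      · exact hyx' (hinj (mem_erase.2 ⟨hya, hyσ⟩) hxa hyx)
    · rintro (rfl | rfl)
      · exact ⟨haσ, ha⟩
      · refine ⟨hbσ, ?_⟩
        rw [← ha]
        ext i
        simp only [mem_image, mem_erase]
        constructor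
        · rintro ⟨y, ⟨hyb, hyσ⟩, rfl⟩
          by_cases hya : y = a
          · exact ⟨x, ⟨hba, hbσ⟩, by rw [hbc, hya]⟩
          · exact ⟨y, ⟨hya, hyσ⟩, rfl⟩
        · rintro ⟨y, ⟨hya, hyσ⟩, rfl⟩
          by_cases hyb : y = x
          · exact ⟨a, ⟨hba.symm, haσ⟩, by rw [hyb, hbc]⟩
          · exact ⟨y, ⟨hyb, hyσ⟩, rfl⟩
  rw [hset, card_pair hba.symm]
  exact even_two

/-- **Scarf's lemma**: every colouring that gives each slack element its own colour has a
dominating set carrying all colours. -/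
theorem exists_isDominating_image_eq_univ [Fintype I] [Nonempty I] [Fintype S] [DecidableEq I]
    (hinj : ∀ i, Function.Injective (h i)) {e : I → S} (he : Function.Injective e)
    (hbot : ∀ i y, y ≠ e i → h i (e i) < h i y)
    (hslack : ∀ i j, j ≠ i → ∀ t, (∀ k, t ≠ e k) → h i t < h i (e j))
    (c : S → I) (hc : ∀ i, c (e i) = i) :
    ∃ σ : Finset S, IsDominating h σ ∧ σ.image c = univ := by
  classical
  by_contra! hno
  let i₀ : I := Classical.arbitrary I
  -- Incidences between doors and rooms are counted modulo 2: `τ₀` lies in one room, every other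
  -- door in two, and every room has evenly many doors if none carries all colours.
  let rooms : Finset (Finset S) := {σ | #σ = Fintype.card I ∧ IsDominating h σ}
  let doors : Finset (Finset S) :=
    {τ | #τ + 1 = Fintype.card I ∧ IsDominating h τ ∧ τ.image c = univ.erase i₀}
  let τ₀ : Finset S := (univ.erase i₀).image e
  have hbelow : ∀ τ ∈ doors, #(rooms.bipartiteAbove (· ⊆ ·) τ) =
      #{x | x ∉ τ ∧ IsDominating h (insert x τ)} := by
    intro τ hτ
    simp only [doors, mem_filter, mem_univ, true_and] at hτ
    symm
    refine card_bij (fun x _ ↦ insert x τ) ?_ ?_ ?_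
    · intro x hx
      simp only [mem_filter, mem_univ, true_and] at hx
      simp only [bipartiteAbove, rooms, mem_filter, mem_univ, true_and]
      exact ⟨⟨by rw [card_insert_of_notMem hx.1, hτ.1], hx.2⟩, subset_insert x τ⟩
    · intro x hx y hy hxy
      simp only [mem_filter, mem_univ, true_and] at hx hy
      exact (insert_inj hx.1).1 hxy
    · intro σ hσ
      simp only [bipartiteAbove, rooms, mem_filter, mem_univ, true_and] at hσ
      obtain ⟨x, hx, rfl⟩ := (covBy_iff_card_sdiff_eq_one.2 ⟨hσ.2, by
        rw [card_sdiff_of_subset hσ.2]; omega⟩).exists_finset_insert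
      exact ⟨x, by simpa using ⟨hx, hσ.1.2⟩, rfl⟩
  have habove : ∀ σ ∈ rooms, Even #(doors.bipartiteBelow (· ⊆ ·) σ) := by
    intro σ hσ
    simp only [rooms, mem_filter, mem_univ, true_and] at hσ
    convert even_card_facets c i₀ hσ.1 (hno σ hσ.2) using 1
    symm
    refine card_bij (fun x _ ↦ σ.erase x) ?_ ?_ ?_
    · intro x hx
      simp only [mem_filter] at hx
      simp only [bipartiteBelow, doors, mem_filter, mem_univ, true_and]
      exact ⟨⟨by rw [card_erase_add_one hx.1, hσ.1], hσ.2.mono (erase_subset _ _), hx.2⟩,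
        erase_subset _ _⟩
    · intro x hx y hy hxy
      simp only [mem_filter] at hx hy
      exact erase_injOn σ hx.1 hy.1 hxy
    · intro τ hτ
      simp only [bipartiteBelow, doors, mem_filter, mem_univ, true_and] at hτ
      obtain ⟨x, hx, rfl⟩ := (covBy_iff_card_sdiff_eq_one.2 ⟨hτ.2, by
        rw [card_sdiff_of_subset hτ.2]; omega⟩).exists_finset_insert
      refine ⟨x, ?_, erase_insert hx⟩
      rw [mem_filter, erase_insert hx]
      exact ⟨mem_insert_self x τ, hτ.1.2.2⟩
  have hτ₀ : τ₀ ∈ doors := by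
    simp only [doors, τ₀, mem_filter, mem_univ, true_and]
    refine ⟨?_, fun y ↦ ?_, ?_⟩
    · rw [card_image_of_injective _ he, card_erase_add_one (mem_univ _), card_univ]
    · by_cases hy : ∃ k, k ≠ i₀ ∧ y = e k
      · obtain ⟨k, hk, rfl⟩ := hy
        refine ⟨k, fun x _ ↦ ?_⟩
        obtain rfl | hx := eq_or_ne x (e k)
        · exact le_rfl
        · exact (hbot k x hx).le
      · refine ⟨i₀, fun x hx ↦ ?_⟩
        simp only [mem_image, mem_erase, mem_univ, and_true] at hx
        obtain ⟨l, hl, rfl⟩ := hx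
        by_cases hy₀ : y = e i₀
        · rw [hy₀]
          exact (hbot i₀ _ fun hh ↦ hl (he hh)).le
        · refine (hslack i₀ l hl y fun k hk ↦ ?_).le
          by_cases hki : k = i₀
          · exact hy₀ (hki ▸ hk)
          · exact hy ⟨k, hki, hk⟩
    · ext i
      simp [hc]
  have hodd : ∀ τ ∈ doors.erase τ₀, Even #(rooms.bipartiteAbove (· ⊆ ·) τ) := by
    intro τ hτ
    obtain ⟨hne, hτ⟩ := mem_erase.1 hτ
    rw [hbelow τ hτ]
    simp only [doors, mem_filter, mem_univ, true_and] at hτ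
    -- A door made of slack elements alone is determined by its colours, hence equals `τ₀`.
    have hex : ∃ t ∈ τ, ∀ k, t ≠ e k := by
      by_contra! hall
      apply hne
      ext y
      simp only [τ₀, mem_image, mem_erase, mem_univ, and_true]
      constructor
      · intro hy
        obtain ⟨k, rfl⟩ := hall y hy
        refine ⟨k, ?_, rfl⟩
        have := mem_image_of_mem c hy
        rw [hτ.2.2, hc] at this
        exact ne_of_mem_erase this
      · rintro ⟨k, hk, rfl⟩
        have : k ∈ τ.image c := by rw [hτ.2.2]; simpa using hk
        obtain ⟨z, hz, hzk⟩ := mem_image.1 this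
        obtain ⟨l, rfl⟩ := hall z hz
        rw [hc] at hzk
        exact hzk ▸ hz
    obtain ⟨t, htτ, ht⟩ := hex
    rw [hτ.2.1.card_extensions hinj hslack hτ.1 htτ ht]
    exact even_two
  have hsum := sum_card_bipartiteAbove_eq_sum_card_bipartiteBelow (s := doors) (t := rooms)
    (· ⊆ ·)
  rw [← add_sum_erase _ _ hτ₀, hbelow τ₀ hτ₀,
    card_extensions_slack hinj hbot hslack i₀ rfl he] at hsum
  have h1 := even_sum _ hodd
  have h2 := even_sum _ habove
  rw [← hsum, Nat.even_add] at h2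
  simp [h1] at h2

end Scarf

/-! ### Colourings of lattice points in a dilated simplex -/

section Grid

open Finset

/-- If every lattice point with coordinate sum `N` fails to exceed the points `z j` in some
coordinate of `C`, then the points `z j` with coordinate sum `N` are close to each other. -/
theorem exists_lower_bound_of_forall_exists_le {I : Type*} [Fintype I] {N : ℕ} {C : Finset I}
    (hC : C.Nonempty) {z : I → I → ℕ} (hz : ∀ j ∈ C, ∑ i, z j i = N)
    (hle : ∀ y : I → ℕ, ∑ i, y i = N → ∃ i ∈ C, ∀ j ∈ C, y i ≤ z j i) :
    ∃ k : I → ℕ, ∀ j ∈ C, ∀ i, k i ≤ z j i ∧ z j i < k i + Fintype.card I ∧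
      (i ∉ C → k i = 0) := by
  classical
  choose a ha hamin using fun i ↦ C.exists_min_image (fun j ↦ z j i) hC
  -- Otherwise raising each minimum over `C` by one, with the remaining mass put on one coordinate,
  -- gives a lattice point violating `hle`. So the minima sum to more than `N - #C`, which bounds
  -- every deviation.
  have hsum : N < ∑ i ∈ C, (z (a i) i + 1) := by
    by_contra! hN
    obtain ⟨i₀, hi₀⟩ := hC
    let y : I → ℕ := fun i ↦ (if i ∈ C then z (a i) i + 1 else 0) +
      if i = i₀ then N - ∑ i ∈ C, (z (a i) i + 1) else 0
    obtain ⟨i, hi, hiy⟩ := hle y (by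
      simp only [y, sum_add_distrib, sum_ite_mem, univ_inter, sum_ite_eq', mem_univ, if_true]
      simp only [sum_add_distrib] at hN ⊢
      omega)
    have h1 := hiy _ (ha i)
    simp only [y, if_pos hi] at h1
    omega
  rw [sum_add_distrib, sum_const, smul_eq_mul, mul_one] at hsum
  have hcard : #C ≤ Fintype.card I := card_le_univ C
  refine ⟨fun i ↦ if i ∈ C then z (a i) i else 0, fun j hj i ↦ ?_⟩
  have hzj := hz j hj
  rw [← sum_add_sum_compl C] at hzj
  have hmono : ∑ i ∈ C, z (a i) i ≤ ∑ i ∈ C, z j i := sum_le_sum fun i _ ↦ hamin i j hj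
  by_cases hi : i ∈ C
  · simp only [if_pos hi]
    refine ⟨hamin i j hj, ?_, fun h ↦ absurd hi h⟩
    rw [← add_sum_erase _ _ hi] at hsum hzj
    have : ∑ i ∈ C.erase i, z (a i) i ≤ ∑ i ∈ C.erase i, z j i :=
      sum_le_sum fun i _ ↦ hamin i j hj
    omega
  · simp only [if_neg hi]
    refine ⟨Nat.zero_le _, ?_, fun _ ↦ trivial⟩
    have : z j i ≤ ∑ i ∈ Cᶜ, z j i :=
      single_le_sum (f := fun i ↦ z j i) (fun _ _ ↦ Nat.zero_le _) (mem_compl.2 hi)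
    omega

/-- For every colouring of the lattice points of the dilated simplex there are a nonempty set `C` of
coordinates and, for every `j ∈ C`, a point `z j` of colour `j`, such that all these points are
close to each other and to the face spanned by `C`. -/
theorem exists_close_lattice_points {I : Type*} [Fintype I] [Nonempty I] (N : ℕ)
    (c : (I → ℕ) → I) :
    ∃ (C : Finset I) (z : I → I → ℕ) (k : I → ℕ), C.Nonempty ∧
      (∀ j ∈ C, ∑ i, z j i = N ∧ c (z j) = j) ∧
      ∀ j ∈ C, ∀ i, k i ≤ z j i ∧ z j i < k i + Fintype.card I ∧ (i ∉ C → k i = 0) := by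
  classical
  let S := I ⊕ (piAntidiag (univ : Finset I) N : Finset (I → ℕ))
  have hT : ∀ t : (piAntidiag (univ : Finset I) N : Finset (I → ℕ)), ∑ i, t.1 i = N :=
    fun t ↦ by have := t.2; rw [mem_piAntidiag] at this; exact this.1
  -- The slack element of `i` lies below everything in order `i` and above all lattice points in the
  -- other orders. Ties are broken below by an enumeration of `S`.
  let val : I → S → ℤ := fun i s ↦
    Sum.elim (fun j ↦ if j = i then -1 else (N : ℤ) + 1) (fun t ↦ (t.1 i : ℤ)) s
  let h : I → S → ℤ ×ₗ Fin (Fintype.card S) := fun i s ↦ toLex (val i s, Fintype.equivFin S s)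
  have hval : ∀ i s s', h i s ≤ h i s' → val i s ≤ val i s' := fun i s s' hs ↦ by
    rcases Prod.Lex.toLex_le_toLex.1 hs with hs | hs
    · exact hs.le
    · exact hs.1.le
  have hlt : ∀ i s s', val i s < val i s' → h i s < h i s' := fun i s s' hs ↦
    Prod.Lex.toLex_lt_toLex.2 (Or.inl hs)
  have htN : ∀ (t : (piAntidiag (univ : Finset I) N : Finset (I → ℕ))) i, t.1 i ≤ N :=
    fun t i ↦ (single_le_sum (f := t.1) (fun _ _ ↦ Nat.zero_le _) (mem_univ i)).trans (hT t).le
  let c' : S → I := Sum.elim id fun t ↦ c t.1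
  obtain ⟨σ, hσ, hcσ⟩ := exists_isDominating_image_eq_univ (h := h) (e := Sum.inl)
    (fun i s s' hs ↦ by
      have := congrArg (fun p ↦ (ofLex p).2) hs
      exact (Fintype.equivFin S).injective this)
    Sum.inl_injective
    (fun i y hy ↦ hlt _ _ _ (by
      rcases y with j | t
      · have hj : j ≠ i := fun hh ↦ hy (hh ▸ rfl)
        simp only [val, Sum.elim_inl, if_true, if_neg hj]
        omega
      · simp only [val, Sum.elim_inl, Sum.elim_inr, if_true]
        omega))
    (fun i j hij t ht ↦ hlt _ _ _ (by
      rcases t with k | t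
      · exact absurd rfl (ht k)
      · have := htN t i
        simp only [val, Sum.elim_inl, Sum.elim_inr, if_neg hij]
        omega))
    c' (fun i ↦ rfl)
  let C : Finset I := {i | Sum.inl i ∉ σ}
  have hC : ∀ i, i ∈ C ↔ Sum.inl i ∉ σ := fun i ↦ by simp [C]
  have hex : ∀ j, ∃ w : I → ℕ, j ∈ C → ∃ hw : w ∈ piAntidiag (univ : Finset I) N,
      (Sum.inr ⟨w, hw⟩ : S) ∈ σ ∧ c w = j := by
    intro j
    by_cases hj : j ∈ C
    · have : j ∈ σ.image c' := hcσ ▸ mem_univ j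
      obtain ⟨s, hs, hsj⟩ := mem_image.1 this
      rcases s with i | t
      · have hij : i = j := hsj
        exact absurd (hij ▸ hs) ((hC j).1 hj)
      · exact ⟨t.1, fun _ ↦ ⟨t.2, hs, hsj⟩⟩
    · exact ⟨0, fun hh ↦ absurd hh hj⟩
  choose z hz using hex
  have hdom : ∀ y : I → ℕ, ∑ i, y i = N → ∃ i ∈ C, ∀ j ∈ C, y i ≤ z j i := by
    intro y hy
    have hyT : y ∈ piAntidiag (univ : Finset I) N := by simp [mem_piAntidiag, hy]
    obtain ⟨i, hi⟩ := hσ (Sum.inr ⟨y, hyT⟩)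
    -- A slack element `i` in `σ` has value `-1`, so order `i` cannot witness domination of a
    -- lattice point.
    refine ⟨i, (hC i).2 fun hiσ ↦ ?_, fun j hj ↦ ?_⟩
    · have := hval _ _ _ (hi _ hiσ)
      simp only [val, Sum.elim_inl, Sum.elim_inr, if_true] at this
      omega
    · obtain ⟨hw, hwσ, -⟩ := hz j hj
      have := hval _ _ _ (hi _ hwσ)
      simp only [val, Sum.elim_inr] at this
      exact_mod_cast this
  have hCne : C.Nonempty := by
    let i₀ : I := Classical.arbitrary I
    obtain ⟨i, hi, -⟩ := hdom (Pi.single i₀ N) (by simp)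
    exact ⟨i, hi⟩
  have hzN : ∀ j ∈ C, ∑ i, z j i = N ∧ c (z j) = j := fun j hj ↦
    let ⟨hw, _, hcw⟩ := hz j hj
    ⟨hT ⟨_, hw⟩, hcw⟩
  obtain ⟨k, hk⟩ := exists_lower_bound_of_forall_exists_le hCne (fun j hj ↦ (hzN j hj).1) hdom
  exact ⟨C, z, k, hCne, hzN, hk⟩

end Grid

/-! ### Brouwer's theorem on the standard simplex -/

section Brouwer

open Finset

/-- Approximate fixed points of continuous self-maps of the standard simplex. -/
theorem exists_forall_le_apply_add {I : Type*} [Fintype I]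
    [Nonempty I] {f : stdSimplex ℝ I → stdSimplex ℝ I} (hf : Continuous f) {ε : ℝ} (hε : 0 < ε) :
    ∃ x : stdSimplex ℝ I, ∀ i, x.1 i ≤ (f x).1 i + ε := by
  classical
  have hlabel : ∀ x : stdSimplex ℝ I, ∃ i, x.1 i ≤ (f x).1 i := by
    intro x
    by_contra! hx
    have := sum_lt_sum_of_nonempty (univ_nonempty (α := I)) fun i _ ↦ hx i
    rw [x.2.2, (f x).2.2] at this
    exact lt_irrefl _ this
  obtain ⟨δ, hδ, hfδ⟩ := Metric.uniformContinuous_iff.1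
    (CompactSpace.uniformContinuous_of_continuous hf) (ε / 2) (half_pos hε)
  obtain ⟨N, hN⟩ := exists_nat_gt ((Fintype.card I : ℝ) / min δ (ε / 2))
  have hmin : 0 < min δ (ε / 2) := lt_min hδ (half_pos hε)
  have hcard : (0 : ℝ) < Fintype.card I := by exact_mod_cast Fintype.card_pos
  have hNpos : (0 : ℝ) < N := (div_pos hcard hmin).trans hN
  have hsmall : (Fintype.card I : ℝ) / N < min δ (ε / 2) := by
    rw [div_lt_iff₀ hmin] at hN
    rw [div_lt_iff₀ hNpos]
    linarith
  have hmem : ∀ w : I → ℕ, ∑ i, w i = N → (fun i ↦ (w i : ℝ) / N) ∈ stdSimplex ℝ I := by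
    intro w hw
    refine ⟨fun i ↦ by positivity, ?_⟩
    rw [← sum_div, ← Nat.cast_sum, hw, div_self hNpos.ne']
  -- A lattice point is coloured by a coordinate that `f` does not decrease.
  have hcol : ∀ w : I → ℕ, ∃ i, ∀ hw : ∑ i, w i = N,
      (w i : ℝ) / N ≤ (f ⟨_, hmem w hw⟩).1 i := by
    intro w
    by_cases hw : ∑ i, w i = N
    · obtain ⟨i, hi⟩ := hlabel ⟨_, hmem w hw⟩
      exact ⟨i, fun _ ↦ hi⟩
    · exact ⟨Classical.arbitrary I, fun h ↦ absurd h hw⟩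
  choose c hc using hcol
  have hc' : ∀ w (hw : ∑ i, w i = N) l, c w = l →
      (w l : ℝ) / N ≤ (f ⟨_, hmem w hw⟩).1 l := by
    rintro w hw _ rfl
    exact hc w hw
  obtain ⟨C, z, k, ⟨j₀, hj₀⟩, hz, hk⟩ := exists_close_lattice_points N c
  let p : ∀ j ∈ C, stdSimplex ℝ I := fun j hj ↦ ⟨_, hmem (z j) (hz j hj).1⟩
  have hdist : ∀ j (hj : j ∈ C) i, |((p j hj).1 i) - (p j₀ hj₀).1 i| ≤
      (Fintype.card I : ℝ) / N := by
    intro j hj i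
    obtain ⟨h1, h2, -⟩ := hk j hj i
    obtain ⟨h3, h4, -⟩ := hk j₀ hj₀ i
    have h1' : (k i : ℝ) ≤ z j i := by exact_mod_cast h1
    have h2' : (z j i : ℝ) ≤ k i + Fintype.card I := by exact_mod_cast h2.le
    have h3' : (k i : ℝ) ≤ z j₀ i := by exact_mod_cast h3
    have h4' : (z j₀ i : ℝ) ≤ k i + Fintype.card I := by exact_mod_cast h4.le
    change |(z j i : ℝ) / N - z j₀ i / N| ≤ _
    rw [← sub_div, abs_div, abs_of_pos hNpos]
    gcongr
    rw [abs_le]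
    constructor <;> linarith
  refine ⟨p j₀ hj₀, fun i ↦ ?_⟩
  have hnonneg : 0 ≤ (f (p j₀ hj₀)).1 i := (f (p j₀ hj₀)).2.1 i
  -- For `i ∈ C` the nearby point of colour `i` gives the inequality, at a cost of `ε / 2` for the
  -- points and `ε / 2` for their images. For `i ∉ C` the coordinate itself is below `ε / 2`.
  by_cases hi : i ∈ C
  · have h1 : (p i hi).1 i ≤ (f (p i hi)).1 i := 
      hc' _ (hz i hi).1 i (hz i hi).2
    have h2 := abs_le.1 (hdist i hi i)
    have h3 : dist (p i hi) (p j₀ hj₀) < δ :=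
      ((dist_pi_le_iff (by positivity)).2 fun l ↦ hdist i hi l).trans_lt
        (hsmall.trans_le (min_le_left _ _))
    have h4 := (dist_le_pi_dist (f (p i hi)).1 (f (p j₀ hj₀)).1 i).trans_lt (hfδ h3)
    rw [Real.dist_eq] at h4
    have h5 := abs_lt.1 h4
    have h6 := hsmall.trans_le (min_le_right _ _)
    linarith [h2.1, h5.2]
  · obtain ⟨-, h2, h3⟩ := hk j₀ hj₀ i
    rw [h3 hi, zero_add] at h2
    have h4 : (p j₀ hj₀).1 i ≤ (Fintype.card I : ℝ) / N := by
      change (z j₀ i : ℝ) / N ≤ _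
      gcongr
    have h6 := hsmall.trans_le (min_le_right _ _)
    linarith

/-- **Brouwer's fixed point theorem** for the standard simplex. -/
theorem exists_fixedPoint_stdSimplex {I : Type*} [Fintype I] [Nonempty I]
    {f : stdSimplex ℝ I → stdSimplex ℝ I} (hf : Continuous f) : ∃ x, f x = x := by
  classical
  let g : stdSimplex ℝ I → ℝ := fun x ↦
    univ.sup' univ_nonempty fun i ↦ x.1 i - (f x).1 i
  have hg : Continuous g := Continuous.finset_sup'_apply _ fun i _ ↦
    ((continuous_apply i).comp continuous_subtype_val).sub
      ((continuous_apply i).comp (continuous_subtype_val.comp hf))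
  have : Nonempty (stdSimplex ℝ I) :=
    ⟨⟨Pi.single (Classical.arbitrary I) 1, single_mem_stdSimplex ℝ _⟩⟩
  obtain ⟨x, -, hx⟩ := isCompact_univ.exists_isMinOn Set.univ_nonempty hg.continuousOn
  have hgx : g x ≤ 0 := le_of_forall_pos_le_add fun ε hε ↦ by
    obtain ⟨y, hy⟩ := exists_forall_le_apply_add hf hε
    refine (hx (Set.mem_univ y)).trans (sup'_le _ _ fun i _ ↦ ?_)
    linarith [hy i]
  have hle : ∀ i, x.1 i ≤ (f x).1 i := fun i ↦ by
    have := (le_sup' (fun i ↦ x.1 i - (f x).1 i) (mem_univ i)).trans hgx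
    linarith
  refine ⟨x, Subtype.ext (funext fun i ↦ ?_)⟩
  -- Both coordinate sums are 1, so coordinatewise inequality is equality.
  exact ((sum_eq_sum_iff_of_le fun i _ ↦ hle i).1 (by rw [x.2.2, (f x).2.2]) i (mem_univ i)).symm

end Brouwer

/-! ### Schauder projection and the fixed point theorem -/

section FixedPoint

open Finset

/-- The supremum of the absolute values of a finite family of functionals. -/
noncomputable def finsetSupAbs {X Λ : Type*} (u : Λ → X → ℝ) (F : Finset Λ) (x : X) : ℝ≥0 :=
  F.sup fun i ↦ ‖u i x‖₊

theorem continuous_finsetSupAbs {X Λ : Type*} [TopologicalSpace X] {u : Λ → X → ℝ}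
    (hu : ∀ i, Continuous (u i)) (F : Finset Λ) : Continuous (finsetSupAbs u F) :=
  Continuous.finset_sup_apply fun i _ ↦ (hu i).nnnorm

variable {X : Type*} [AddCommGroup X] [Module ℝ X]

/-- The sublevel set is a finite intersection of sublevel sets of the `|u i|`, each convex by
m-quasiconvexity. -/
theorem OriginallyMQuasiconvex.convex_finsetSupAbs_lt {Λ : Type*} {u : Λ → X → ℝ}
    (hu : ∀ i, OriginallyMQuasiconvex (u i)) (F : Finset Λ) {r : ℝ≥0} (hr : 0 < r) :
    Convex ℝ {x | finsetSupAbs u F x < r} := by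
  intro x hx y hy a b ha hb hab
  simp only [Set.mem_ofPred_eq, finsetSupAbs, Finset.sup_lt_iff (show ⊥ < r from hr)] at *
  intro i hi
  obtain rfl : b = 1 - a := by linarith
  have h1 := (hu i).mQuasiconvex x y a ha (by linarith)
  have h2 : ‖u i (a • x + (1 - a) • y)‖₊ ≤ max ‖u i x‖₊ ‖u i y‖₊ := by
    rw [← NNReal.coe_le_coe]
    simpa using h1
  exact h2.trans_lt (max_lt (hx i hi) (hy i hi))

/-- A compact convex set has the fixed point property up to any continuous gauge with convex
sublevel set at the level considered. -/
theorem exists_gauge_sub_lt [TopologicalSpace X] [IsTopologicalAddGroup X] [ContinuousSMul ℝ X]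
    {q : X → ℝ≥0} (hq : Continuous q) (hq0 : q 0 = 0) {r : ℝ≥0} (hr : 0 < r)
    (hqr : Convex ℝ {x | q x < r})
    {C : Set X} (hne : C.Nonempty) (hcompact : IsCompact C) (hconvex : Convex ℝ C)
    {f : C → C} (hf : Continuous f) : ∃ x : C, q (x - f x) < r := by
  classical
  obtain ⟨s, hs⟩ := (isCompact_iff_isCompact_univ.1 hcompact).elim_finite_subcover
    (fun c : C ↦ {y : C | q (c - y) < r})
    (fun c ↦ isOpen_lt (hq.comp (continuous_const.sub continuous_subtype_val)) continuous_const)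
    (fun y _ ↦ Set.mem_iUnion.2 ⟨y, by simpa [hq0] using hr⟩)
  have hcover : ∀ y : C, ∃ c : s, q (c.1 - y) < r := fun y ↦ by
    simpa using hs (Set.mem_univ y)
  have : Nonempty s := ⟨(hcover ⟨_, hne.some_mem⟩).choose⟩
  -- Normalised, these weights form a partition of unity in which `c` has positive weight at `y`
  -- only if `q (c - y) < r`.
  let w : s → C → ℝ := fun c y ↦ max 0 ((r : ℝ) - q (c.1 - y))
  have hwcont : ∀ c, Continuous (w c) := fun c ↦ by
    have : Continuous fun y : C ↦ q ((c.1 : X) - y) :=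
      hq.comp (continuous_const.sub continuous_subtype_val)
    exact continuous_const.max (continuous_const.sub (NNReal.continuous_coe.comp this))
  have hw0 : ∀ c y, 0 ≤ w c y := fun c y ↦ le_max_left _ _
  have hwsum : ∀ y, 0 < ∑ c, w c y := fun y ↦ by
    obtain ⟨c, hc⟩ := hcover y
    refine sum_pos' (fun c _ ↦ hw0 c y) ⟨c, mem_univ c, lt_max_of_lt_right ?_⟩
    have : (q (c.1 - y) : ℝ) < r := by exact_mod_cast hc
    linarith
  let φ : C → stdSimplex ℝ s := fun y ↦ ⟨fun c ↦ w c y / ∑ c, w c y,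
    fun c ↦ div_nonneg (hw0 c y) (hwsum y).le, by
      rw [← sum_div, div_self (hwsum y).ne']⟩
  have hφ : Continuous φ := Continuous.subtype_mk (continuous_pi fun c ↦
    (hwcont c).div (continuous_finsetSum _ fun c _ ↦ hwcont c) fun y ↦ (hwsum y).ne') _
  let P : stdSimplex ℝ s → C := fun t ↦ ⟨∑ c, t.1 c • (c.1 : X),
    hconvex.sum_mem (fun c _ ↦ t.2.1 c) t.2.2 fun c _ ↦ c.1.2⟩
  have hP : Continuous P := Continuous.subtype_mk (continuous_finsetSum _ fun c _ ↦
    ((continuous_apply c).comp continuous_subtype_val).smul continuous_const) _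
  obtain ⟨t, ht⟩ := exists_fixedPoint_stdSimplex (hφ.comp (hf.comp hP))
  refine ⟨P t, ?_⟩
  set y := f (P t) with hy
  have hPt : (P t : X) = ∑ c : s, (φ y).1 c • (c.1 : X) := by
    conv_lhs => rw [← ht]
    rfl
  -- The difference is a convex combination of vectors `c - y`; those with positive weight lie in
  -- the convex sublevel set.
  have hsub : (P t : X) - y = ∑ c : s, (φ y).1 c • ((c.1 : X) - y) := by
    simp only [smul_sub, sum_sub_distrib]
    rw [← sum_smul, (φ y).2.2, one_smul, ← hPt]
  rw [hsub]
  have hfilter : ∑ c : s, (φ y).1 c • ((c.1 : X) - y) =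
      ∑ c : s with 0 < (φ y).1 c, (φ y).1 c • ((c.1 : X) - y) := by
    symm
    refine sum_filter_of_ne fun c _ hc ↦ ?_
    exact lt_of_le_of_ne ((φ y).2.1 c) fun hh ↦ hc (by rw [← hh, zero_smul])
  have hfilter1 : ∑ c : s with 0 < (φ y).1 c, (φ y).1 c = 1 := by
    rw [sum_filter_of_ne fun c _ hc ↦ lt_of_le_of_ne ((φ y).2.1 c) hc.symm, (φ y).2.2]
  rw [hfilter]
  refine hqr.sum_mem (fun c _ ↦ (φ y).2.1 c) hfilter1 fun c hc ↦ ?_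
  have hc' : 0 < w c y / ∑ c, w c y := (mem_filter.1 hc).2
  have hwc : 0 < w c y := (div_pos_iff_of_pos_right (hwsum y)).1 hc'
  have := (lt_max_iff.1 hwc).resolve_left (lt_irrefl _)
  rw [sub_pos] at this
  exact_mod_cast this

end FixedPoint

theorem theorem4p1 {X : Type*} [AddCommGroup X] [Module ℝ X] [TopologicalSpace X]
    [IsTopologicalAddGroup X] [ContinuousSMul ℝ X] [T2Space X]
    {Λ : Type*} (v u : Λ → X → ℝ) (ψ : Λ → ℝ≥0 → ℝ≥0)
    (hsep : IsQuasiPointSeparatingSpace v u ψ)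
    (C : Set X) (hne : C.Nonempty) (hcompact : IsCompact C) (hconvex : Convex ℝ C)
    (f : C → C) (hf : Continuous f) :
    ∃ x : C, f x = x := by
  classical
  by_contra! hfix
  have hexists : ∀ x : C, ∃ i, u i (x - f x) ≠ 0 := by
    intro x
    by_contra! hx
    have h0 : (x : X) - f x = 0 := hsep.separating _ fun i ↦ by
      have := (hsep.generalized i).abs_le (x - f x)
      rw [hx i, nnnorm_zero, (hsep.generalized i).weight_zero, NNReal.coe_zero] at this
      exact abs_nonpos_iff.1 this
    exact hfix x (Subtype.ext (sub_eq_zero.1 h0).symm)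
  have hsubcont : Continuous fun x : C ↦ (x : X) - f x :=
    continuous_subtype_val.sub (continuous_subtype_val.comp hf)
  have : CompactSpace C := isCompact_iff_compactSpace.1 hcompact
  have : Nonempty C := hne.to_subtype
  obtain ⟨F, hF⟩ := isCompact_univ.elim_finite_subcover
    (fun i ↦ {x : C | u i (x - f x) ≠ 0})
    (fun i ↦ isOpen_ne_fun ((hsep.continuous i).comp hsubcont) continuous_const)
    (fun x _ ↦ Set.mem_iUnion.2 (hexists x))
  have hq := continuous_finsetSupAbs hsep.continuous F
  have hqpos : ∀ x : C, 0 < finsetSupAbs u F (x - f x) := fun x ↦ by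
    have := hF (Set.mem_univ x)
    simp only [Set.mem_iUnion] at this
    obtain ⟨i, hi, hx⟩ := this
    exact (nnnorm_pos.2 hx).trans_le (Finset.le_sup (f := fun i ↦ ‖u i ((x : X) - f x)‖₊) hi)
  obtain ⟨x₀, -, hx₀⟩ :=
    isCompact_univ.exists_isMinOn Set.univ_nonempty (hq.comp hsubcont).continuousOn
  have hq0 : finsetSupAbs u F 0 = 0 := by
    simp [finsetSupAbs, (hsep.generalized _).originally.map_zero]
  -- The level is the minimum value itself, so the point obtained falls strictly below the minimum.
  obtain ⟨x, hx⟩ := exists_gauge_sub_lt hq hq0 (hqpos x₀)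
    (OriginallyMQuasiconvex.convex_finsetSupAbs_lt (fun i ↦ (hsep.generalized i).originally) F
      (hqpos x₀)) hne hcompact hconvex hf
  exact (hx₀ (Set.mem_univ x)).not_gt hx
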